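/- **Helmholtz theorem for differential 2-forms in $E_3$.** Let $E_3$ be Euclidean 3-space with Cartesian coordinates $x^1,x^2,x^3$, oriented by $w=dx^1\wedge dx^2\wedge dx^3$. Let $d$ be the exterior derivative and let $\delta u=\sum_h dx^h\cdot\partial_h u$ be the interior derivative, where $dx^h\cdot$ denotes contraction of the first slot with the basis vector $e_h$ (so $\delta(\sum_i a_i\,dx^i)=\sum_i\partial_i a_i$). Let $\beta$ be a differential 2-form of class $C^1$ on $E_3$ that decays sufficiently fast at infinity, in the sense that $\beta(x)\to 0$ as $|x|\to\infty$ and $$\int_{E_3}\frac{|d\beta(y)|}{1+|y|}\,dy<\infty,\qquad \int_{E_3}\frac{|\delta\beta(y)|}{1+|y|}\,dy<\infty .$$ Write $r_{12}=|x-x'|$; primes denote quantities in the integration variable $x'$, and $(i,j,k)$ is the cyclic permutation of $(1,2,3)$ starting with $i$, with $dx'^{jk}=dx'^j\wedge dx'^k$. Then, for every $x$, the integrals $$\int_{E_3'}\frac{\delta'\beta'\wedge dx'^{jk}}{r_{12}}\quad(i=1,2,3),\qquad \int_{E_3'}\frac{d'\beta'\wedge 1}{r_{12}}$$ converge absolutely,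 the forms $\sum_i dx^i\int_{E_3'}\frac{\delta'\beta'\wedge dx'^{jk}}{r_{12}}$ and $w\int_{E_3'}\frac{d'\beta'\wedge 1}{r_{12}}$ are differentiable on $E_3$, and $$\beta=-\frac1{4\pi}\,d\left(\sum_{i=1}^3 dx^i\int_{E_3'}\frac{\delta'\beta'\wedge dx'^{jk}}{r_{12}}\right)-\frac1{4\pi}\,\delta\left(w\int_{E_3'}\frac{d'\beta'\wedge 1}{r_{12}}\right)$$ everywhere on $E_3$. -/

import Mathlib

open scoped Topology ContDiff Nat

noncomputable section

/-- Euclidean three-space, with its Cartesian coordinates. -/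
abbrev E3 : Type := EuclideanSpace ℝ (Fin 3)

/-- The values of real differential `k`-forms on `E3`: alternating `k`-linear forms. -/
abbrev E3Form (k : ℕ) : Type := E3 [⋀^Fin k]→L[ℝ] ℝ

/-- The `i`-th Cartesian basis vector. -/
def cartVec (i : Fin 3) : E3 := EuclideanSpace.single i 1

/-- The exterior product, `(a ∧ b) v = 1/(m! n!) ∑ σ, sign σ * a (v σ(1), …, v σ(m)) *
b (v σ(m+1), …, v σ(m+n))`, normalised so that `dx¹ ∧ dx²` has value `1` on `(e₁, e₂)`. -/
def wedge {m n : ℕ} (a : E3Form m) (b : E3Form n) : E3Form (m + n) :=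
  ((m ! : ℝ) * (n ! : ℝ))⁻¹ •
    ContinuousMultilinearMap.alternatization
      ((a.toContinuousMultilinearMap.smulRight
        b.toContinuousMultilinearMap).uncurrySum.domDomCongr finSumFinEquiv)

/-- The constant `1`-form `dx^i`. -/
def dx (i : Fin 3) : E3Form 1 :=
  ContinuousAlternatingMap.ofSubsingleton ℝ E3 ℝ 0 (EuclideanSpace.proj i)

/-- The constant `0`-form `1`. -/
def oneForm0 : E3Form 0 := ContinuousAlternatingMap.constOfIsEmpty ℝ E3 (Fin 0) 1

/-- The unit `3`-form `w = dx¹ ∧ dx² ∧ dx³`. -/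
def unitForm : E3Form 3 := wedge (wedge (dx 0) (dx 1)) (dx 2)

/-- The interior derivative `δβ = ∑_h dx^h · ∂_h β`, where `dx^h ·` is contraction of the first
slot with `e_h`. (It is the divergence, without an extra sign, on `1`-forms.) The exterior
derivative is Mathlib's `extDeriv`. -/
def intDeriv {k : ℕ} (β : E3 → E3Form (k + 1)) (x : E3) : E3Form k :=
  ∑ h : Fin 3, (fderiv ℝ β x (cartVec h)).curryLeft (cartVec h)

/-- The integral over `E3`, oriented by `(x¹, x², x³)`, of a differential `3`-form. -/
def formIntegral (γ : E3 → E3Form 3) : ℝ := ∫ y, γ y cartVec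

/-- The `3`-form `(δ'β' ∧ dx'^{jk}) / r₁₂` in the primed variable `y`, with `r₁₂ = ‖x - y‖` and
`(i, j, k)` the cyclic permutation of the three indices that starts with `i`. -/
def deltaIntegrand (β : E3 → E3Form 2) (i : Fin 3) (x y : E3) : E3Form 3 :=
  ‖x - y‖⁻¹ • wedge (intDeriv β y) (wedge (dx (i + 1)) (dx (i + 2)))

/-- The `3`-form `(d'β' ∧ 1) / r₁₂` in the primed variable `y`, with `r₁₂ = ‖x - y‖`. -/
def dIntegrand (β : E3 → E3Form 2) (x y : E3) : E3Form 3 :=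
  ‖x - y‖⁻¹ • wedge (extDeriv β y) oneForm0

/-- The `1`-form `dx^i ∫ (δ'β' ∧ dx'^{jk}) / r₁₂`, summed over `i`. -/
def deltaPotential (β : E3 → E3Form 2) (x : E3) : E3Form 1 :=
  ∑ i : Fin 3, formIntegral (deltaIntegrand β i x) • dx i

/-- The `3`-form `w ∫ (d'β' ∧ 1) / r₁₂`. -/
def dPotential (β : E3 → E3Form 2) (x : E3) : E3Form 3 :=
  formIntegral (dIntegrand β x) • unitForm

end

open MeasureTheory Filter

/-! Put B_r = β(e_{r+1}, e_{r+2}), indices mod 3. Then dβ = (div B) w and δβ is the 1-form of -curl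
B, so both potentials have Newtonian potentials as coefficients and the claim is the Helmholtz
decomposition of the vector field B. Only first derivatives of potentials occur, which is why class
C¹ suffices.

Differentiability (`NewtonDensity.hasFDerivAt`): for a continuous density f with |f|/(1+|y|)
integrable, the first-order remainder of 1/|x-y| is at most a multiple of |h|^{3/2} times a sum of
two kernels of order -5/2. These are locally integrable in dimension three, and 3/2 > 1. The
gradient of the potential is then the integral of f against K(z) = z/|z|³, with z = y - x.

Identity (`helmholtz_component`): after this, the r-th component of the right-hand side is an
integral of div B and curl B against K. Replace K by a radial C¹ field g(|z|²)z supported in an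
annulus and integrate by parts. Radial fields are curl-free, so only -div(g(|z|²)z) B_r survives.
That divergence is the difference of two averaging kernels of mass 4π, one at the inner and one at
the outer scale. The inner average tends to 4π B_r(x) by continuity, the outer one to 0 by decay of
β. -/

/-! ### Exterior algebra in Cartesian coordinates. -/

theorem wedge_apply {m n : ℕ} (a : E3Form m) (b : E3Form n) (v : Fin (m + n) → E3) :
    wedge a b v = ((m ! : ℝ) * (n ! : ℝ))⁻¹ * ∑ σ : Equiv.Perm (Fin (m + n)),
      (Equiv.Perm.sign σ : ℤ) * (a (fun i => v (σ (Fin.castAdd n i))) *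
        b (fun j => v (σ (Fin.natAdd m j)))) := by
  simp only [wedge, ContinuousAlternatingMap.smul_apply, smul_eq_mul,
    ContinuousMultilinearMap.alternatization_apply_apply, Units.smul_def, zsmul_eq_mul]
  rfl

@[simp]
theorem cartVec_apply (i j : Fin 3) : cartVec i j = if j = i then 1 else 0 := by
  simp [cartVec]

@[simp]
theorem norm_cartVec (i : Fin 3) : ‖cartVec i‖ = 1 := by
  simp [cartVec]

@[simp]
theorem dx_apply (i : Fin 3) (v : Fin 1 → E3) : dx i v = v 0 i := rfl

/-- Alternating forms that agree on tuples of distinct Cartesian basis vectors are equal. -/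
theorem E3Form.ext_cartVec {k : ℕ} {a b : E3Form k}
    (h : ∀ v : Fin k → Fin 3, Function.Injective v →
      a (fun i => cartVec (v i)) = b (fun i => cartVec (v i))) : a = b := by
  apply ContinuousAlternatingMap.toAlternatingMap_injective
  apply Module.Basis.ext_alternating (EuclideanSpace.basisFun (Fin 3) ℝ).toBasis
  intro v hv
  simpa [cartVec] using h v hv

theorem wedge_dx_dx_apply (i j : Fin 3) (u v : E3) :
    wedge (dx i) (dx j) ![u, v] = u i * v j - u j * v i := by
  rw [wedge_apply]
  simp [Finset.univ_perm_fin_succ, ← Finset.univ_product_univ, Fin.sum_univ_succ]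
  ring

theorem wedge_dx_dx_apply' (i j : Fin 3) (u : Fin 2 → E3) :
    wedge (dx i) (dx j) u = u 0 i * u 1 j - u 0 j * u 1 i := by
  rw [← wedge_dx_dx_apply]
  congr 1
  ext k
  fin_cases k <;> rfl

theorem unitForm_cartVec : unitForm cartVec = 1 := by
  rw [unitForm, wedge_apply]
  simp [Finset.univ_perm_fin_succ, ← Finset.univ_product_univ, Finset.sum_product,
    Fin.sum_univ_succ, Equiv.Perm.decomposeFin.symm_sign, wedge_dx_dx_apply']
  norm_num [Equiv.swap_apply_def, Fin.ext_iff]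

/-- Only the dx^i component of `a` survives against dx^{jk}, and dx^i ∧ dx^{jk} = w because (i, j,
k) is cyclic, hence even. -/
theorem wedge_dx_dx_cartVec (a : E3Form 1) (i : Fin 3) :
    wedge a (wedge (dx (i + 1)) (dx (i + 2))) cartVec = a ![cartVec i] := by
  rw [wedge_apply]
  have h : ∀ v : Fin 1 → E3, a v = a ![v 0] := fun v => by
    congr 1; ext k; fin_cases k; rfl
  simp [Finset.univ_perm_fin_succ, ← Finset.univ_product_univ, Finset.sum_product,
    Fin.sum_univ_succ, Equiv.Perm.decomposeFin.symm_sign, wedge_dx_dx_apply', h (fun _ => _)]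
  have e0 : Equiv.Perm.decomposeFin.symm ((0 : Fin 3), Equiv.swap 0 1) 2 = 1 := by decide
  have e1 : Equiv.Perm.decomposeFin.symm ((1 : Fin 3), Equiv.swap 0 1) 2 = 0 := by decide
  have e2 : Equiv.Perm.decomposeFin.symm ((2 : Fin 3), Equiv.swap 0 1) 2 = 1 := by decide
  rw [e0, e1, e2]
  fin_cases i <;> simp [Equiv.swap_apply_def] <;> ring

theorem wedge_oneForm0_cartVec (a : E3Form 3) : wedge a oneForm0 cartVec = a cartVec := by
  rw [wedge_apply]
  have h : ∀ σ : Equiv.Perm (Fin (3 + 0)), ((Equiv.Perm.sign σ : ℤ) : ℝ) *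
      (a (fun i => cartVec (σ (Fin.castAdd 0 i))) *
        oneForm0 (fun j => cartVec (σ (Fin.natAdd 3 j)))) = a cartVec := by
    intro σ
    have h1 : a (cartVec ∘ σ) = Equiv.Perm.sign σ • a cartVec := a.map_perm cartVec σ
    have h2 : a (fun i => cartVec (σ (Fin.castAdd 0 i))) = a (cartVec ∘ σ) := rfl
    rw [h2, h1]
    have h3 : (((Equiv.Perm.sign σ : ℤ) : ℝ)) * ((Equiv.Perm.sign σ : ℤ) : ℝ) = 1 := by
      rcases Int.units_eq_one_or (Equiv.Perm.sign σ) with h | h <;> simp [h]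
    simp [oneForm0, Units.smul_def, ← mul_assoc, h3]
  rw [Finset.sum_congr rfl fun σ _ => h σ]
  simp [Fintype.card_perm, Nat.factorial]

/-- 3-forms are one-dimensional; this turns integrability of form-valued integrands into a scalar
question. -/
theorem E3Form.eq_smul_unitForm (γ : E3Form 3) : γ = γ cartVec • unitForm := by
  apply E3Form.ext_cartVec
  intro v hv
  let σ : Equiv.Perm (Fin 3) := Equiv.ofBijective v (Finite.injective_iff_bijective.1 hv)
  have h : (fun i => cartVec (v i)) = cartVec ∘ σ := rfl
  have h1 (a : E3Form 3) : a (cartVec ∘ σ) = Equiv.Perm.sign σ • a cartVec := a.map_perm cartVec σ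
  rw [h, h1, ContinuousAlternatingMap.smul_apply, h1, unitForm_cartVec]
  simp [Units.smul_def, mul_comm]

theorem E3Form.two_swap (c : E3Form 2) (u v : E3) : c ![u, v] = - c ![v, u] := by
  have h1 : c (![v, u] ∘ Equiv.swap 0 1) = - c ![v, u] :=
    c.map_swap ![v, u] (i := 0) (j := 1) (by simp)
  rw [← h1]
  congr 1
  ext k
  fin_cases k <;> rfl

theorem E3Form.two_self (c : E3Form 2) (u : E3) : c ![u, u] = 0 :=
  c.map_eq_zero_of_eq _ (i := 0) (j := 1) (by simp) (by simp)

/-- Addition in `Fin 3` wraps around, so the three cyclic pairs cover every pair of distinct indices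
up to order. This identifies a 2-form with a vector field. -/
theorem E3Form.two_ext {a b : E3Form 2}
    (h : ∀ r : Fin 3, a ![cartVec (r + 1), cartVec (r + 2)] =
      b ![cartVec (r + 1), cartVec (r + 2)]) : a = b := by
  apply E3Form.ext_cartVec
  intro v hv
  have hv' : (fun i => cartVec (v i)) = ![cartVec (v 0), cartVec (v 1)] := by
    ext k; fin_cases k <;> rfl
  rw [hv']
  have key : ∀ p q : Fin 3, p ≠ q → ∃ r : Fin 3, (p = r + 1 ∧ q = r + 2) ∨
      (q = r + 1 ∧ p = r + 2) := by decide
  obtain ⟨r, ⟨hp, hq⟩ | ⟨hp, hq⟩⟩ := key _ _ (hv.ne (show (0 : Fin 2) ≠ 1 by decide))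
  · rw [hp, hq, h]
  · rw [hp, hq, two_swap a, two_swap b, h]

/-! ### Radial integrals and estimates for the Newtonian kernel. -/

theorem integral_norm_E3 (f : ℝ → ℝ) :
    ∫ z : E3, f ‖z‖ = 4 * Real.pi * ∫ r in Set.Ioi (0 : ℝ), r ^ 2 * f r := by
  rw [integral_fun_norm_addHaar]
  simp [Measure.real, EuclideanSpace.volume_ball_fin_three]
  rw [ENNReal.toReal_ofReal (by positivity)]
  ring

/-- In polar coordinates the integrand becomes r² r^{-5/2} = r^{-1/2}, integrable at 0. -/
theorem integrable_indicator_ball_rpow :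
    Integrable (fun z : E3 => (Set.Iio (1 : ℝ)).indicator (fun r => r ^ (-(5 / 2) : ℝ)) ‖z‖) := by
  rw [integrable_fun_norm_addHaar volume (f := (Set.Iio (1 : ℝ)).indicator (fun r => r ^ (-(5 / 2) : ℝ)))]
  have h : IntegrableOn (fun r : ℝ => r ^ (-(1 / 2) : ℝ)) (Set.Ioo 0 1) := by
    rw [← intervalIntegrable_iff_integrableOn_Ioo_of_le zero_le_one]
    exact intervalIntegral.intervalIntegrable_rpow' (by norm_num)
  have h2 : IntegrableOn ((Set.Iio (1 : ℝ)).indicator (fun r : ℝ => r ^ (-(1 / 2) : ℝ)))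
      (Set.Ioi 0) := by
    rw [integrableOn_indicator_iff measurableSet_Iio]
    rwa [Set.inter_comm]
  refine h2.congr_fun (fun r hr => ?_) measurableSet_Ioi
  have hr : (0 : ℝ) < r := hr
  by_cases h1 : r < 1
  · simp only [Set.indicator, Set.mem_Iio, h1, if_true, smul_eq_mul, finrank_euclideanSpace,
      Fintype.card_fin]
    rw [← Real.rpow_natCast, ← Real.rpow_add hr]
    norm_num
  · simp [Set.indicator, h1]

/-- The elementary remainder bound in the first-order expansion of the Newtonian kernel. -/
theorem abs_newton_remainder_le (w h : E3) (hw : w ≠ 0) (hwh : w + h ≠ 0) :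
    |‖w + h‖⁻¹ - ‖w‖⁻¹ + inner ℝ w h * (‖w‖⁻¹) ^ 3| ≤
      3 * ‖h‖ ^ 2 * ((‖w‖⁻¹) ^ 2 * ‖w + h‖⁻¹) := by
  have hr : 0 < ‖w‖ := norm_pos_iff.2 hw
  have hs : 0 < ‖w + h‖ := norm_pos_iff.2 hwh
  have h1 : ‖w + h‖ ^ 2 = ‖w‖ ^ 2 + 2 * inner ℝ w h + ‖h‖ ^ 2 := norm_add_sq_real w h
  have h2 : |inner ℝ w h| ≤ ‖w‖ * ‖h‖ := abs_real_inner_le_norm w h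
  have h3 : |‖w + h‖ - ‖w‖| ≤ ‖h‖ := by simpa using abs_norm_sub_norm_le (w + h) w
  generalize ‖w‖ = r at *
  generalize ‖w + h‖ = s at *
  have ha : 0 ≤ ‖h‖ := norm_nonneg h
  generalize ‖h‖ = a at *
  generalize inner ℝ w h = t at *
  -- Eliminating t through s² = r² + 2t + a² makes the remainder visibly quadratic: |t| ≤ ra and |s
  -- - r| ≤ a bound the first term, and a² is explicit in the second.
  have e : s⁻¹ - r⁻¹ + t * r⁻¹ ^ 3 =
      t * (s - r) * (s + 2 * r) / (r ^ 3 * s * (r + s)) - a ^ 2 / (r * s * (r + s)) := by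
    have : t = (s ^ 2 - r ^ 2 - a ^ 2) / 2 := by linarith
    field_simp
    rw [this]; ring
  rw [e]
  have b1 : |t * (s - r) * (s + 2 * r) / (r ^ 3 * s * (r + s))| ≤ 2 * a ^ 2 / (r ^ 2 * s) := by
    rw [abs_div, abs_of_pos (show 0 < r ^ 3 * s * (r + s) by positivity), abs_mul, abs_mul,
      abs_of_pos (show 0 < s + 2 * r by positivity), div_le_div_iff₀ (by positivity) (by positivity)]
    have : |t| * |s - r| ≤ r * a * a := by gcongr
    calc |t| * |s - r| * (s + 2 * r) * (r ^ 2 * s) ≤ (r * a * a) * (2 * (r + s)) * (r ^ 2 * s) := by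
          gcongr; linarith
      _ = _ := by ring
  have b2 : |a ^ 2 / (r * s * (r + s))| ≤ a ^ 2 / (r ^ 2 * s) := by
    rw [abs_of_nonneg (by positivity)]
    apply div_le_div_of_nonneg_left (by positivity) (by positivity)
    nlinarith [mul_pos hr hs, mul_pos (mul_pos hr hs) hs]
  calc _ ≤ _ := abs_sub _ _
    _ ≤ 2 * a ^ 2 / (r ^ 2 * s) + a ^ 2 / (r ^ 2 * s) := add_le_add b1 b2
    _ = _ := by field_simp; ring

/-- Half a power of a is traded against the larger radius, using a ≤ r + s. What remains separates
into one singularity per centre, of order 5/2 < 3, while the power 3/2 of a still exceeds 1. -/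
theorem newton_remainder_rpow_le {r s a : ℝ} (hr : 0 < r) (hs : 0 < s) (ha : 0 ≤ a)
    (h : a ≤ r + s) :
    a ^ 2 * ((r⁻¹) ^ 2 * s⁻¹) ≤
      2 * a ^ (3 / 2 : ℝ) * (r ^ (-(5 / 2) : ℝ) + s ^ (-(5 / 2) : ℝ)) := by
  -- compare with the smaller of the two radii
  have e1 : a ^ 2 = a ^ (3 / 2 : ℝ) * a ^ (1 / 2 : ℝ) := by
    rw [← Real.rpow_add_of_nonneg ha (by norm_num) (by norm_num), ← Real.rpow_natCast]; norm_num
  have key : ∀ m M : ℝ, 0 < m → m ≤ M → a ≤ m + M → (r⁻¹) ^ 2 * s⁻¹ ≤ (m⁻¹) ^ 2 * M⁻¹ →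
      a ^ 2 * ((r⁻¹) ^ 2 * s⁻¹) ≤ 2 * a ^ (3 / 2 : ℝ) * m ^ (-(5 / 2) : ℝ) := by
    intro m M hm hmM haM hk
    have hM : 0 < M := hm.trans_le hmM
    have h1 : a ^ (1 / 2 : ℝ) ≤ 2 * M ^ (1 / 2 : ℝ) := by
      calc a ^ (1 / 2 : ℝ) ≤ (4 * M) ^ (1 / 2 : ℝ) :=
            Real.rpow_le_rpow ha (by linarith) (by norm_num)
        _ = 2 * M ^ (1 / 2 : ℝ) := by
            rw [Real.mul_rpow (by norm_num) hM.le, ← Real.sqrt_eq_rpow 4,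
              show (4 : ℝ) = 2 ^ 2 by norm_num, Real.sqrt_sq (by norm_num)]
    have h2 : M ^ (1 / 2 : ℝ) * M⁻¹ ≤ m ^ (-(1 / 2) : ℝ) := by
      rw [← Real.rpow_neg_one M, ← Real.rpow_add hM]
      norm_num
      exact Real.rpow_le_rpow_of_nonpos hm hmM (by norm_num)
    have h3 : m ^ (-(5 / 2) : ℝ) = (m⁻¹) ^ 2 * m ^ (-(1 / 2) : ℝ) := by
      rw [← Real.rpow_natCast, ← Real.rpow_neg_one, ← Real.rpow_mul hm.le, ← Real.rpow_add hm]
      norm_num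
    calc a ^ 2 * ((r⁻¹) ^ 2 * s⁻¹) ≤ a ^ 2 * ((m⁻¹) ^ 2 * M⁻¹) := by gcongr
      _ = a ^ (3 / 2 : ℝ) * (a ^ (1 / 2 : ℝ) * ((m⁻¹) ^ 2 * M⁻¹)) := by rw [e1]; ring
      _ ≤ a ^ (3 / 2 : ℝ) * ((2 * M ^ (1 / 2 : ℝ)) * ((m⁻¹) ^ 2 * M⁻¹)) := by gcongr
      _ = 2 * a ^ (3 / 2 : ℝ) * ((m⁻¹) ^ 2 * (M ^ (1 / 2 : ℝ) * M⁻¹)) := by ring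
      _ ≤ _ := by rw [h3]; gcongr
  have hp : 0 ≤ a ^ (3 / 2 : ℝ) := by positivity
  have hr' : 0 ≤ r ^ (-(5 / 2) : ℝ) := by positivity
  have hs' : 0 ≤ s ^ (-(5 / 2) : ℝ) := by positivity
  rcases le_total r s with hrs | hrs
  · refine (key r s hr hrs h le_rfl).trans ?_
    gcongr; linarith
  · refine (key s r hs hrs (by linarith) ?_).trans ?_
    · have : r⁻¹ ≤ s⁻¹ := by gcongr
      calc r⁻¹ ^ 2 * s⁻¹ = r⁻¹ * (r⁻¹ * s⁻¹) := by ring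
        _ ≤ s⁻¹ * (r⁻¹ * s⁻¹) := by gcongr
        _ = _ := by ring
    · gcongr; linarith

/-! ### Differentiability of Newtonian potentials. -/

/-- Densities whose Newtonian potential converges absolutely. -/
structure NewtonDensity (f : E3 → ℝ) : Prop where
  continuous : Continuous f
  integrable_div : Integrable (fun y => |f y| / (1 + ‖y‖))

namespace NewtonDensity

variable {f : E3 → ℝ}

/-- Within distance 1 of x' the density is bounded and the kernel is at most its -5/2 power; farther
away the kernel is at most a multiple of 1/(1+|y|). The majorant moves with x', but its integral
does not exceed a fixed C, by translation invariance. -/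
theorem exists_rpow_bound (hf : NewtonDensity f) (x : E3) :
    ∃ C : ℝ, ∀ x' ∈ Metric.ball x 1, ∃ g : E3 → ℝ, Integrable g ∧ ∫ y, g y ≤ C ∧
      ∀ (y : E3), x' ≠ y → ∀ p : ℝ, 1 ≤ p → p ≤ 5 / 2 → |f y| * ‖x' - y‖ ^ (-p) ≤ g y := by
  obtain ⟨M, hM⟩ := (isCompact_closedBall x 2).exists_bound_of_continuousOn
    hf.continuous.continuousOn
  have hM0 : 0 ≤ M := (norm_nonneg _).trans (hM x (by simp))
  set J : E3 → ℝ := fun z => (Set.Iio (1 : ℝ)).indicator (fun r => r ^ (-(5 / 2) : ℝ)) ‖z‖ with hJ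
  have hJint : Integrable J := integrable_indicator_ball_rpow
  refine ⟨M * (∫ z, J z) + (3 + ‖x‖) * ∫ y, |f y| / (1 + ‖y‖), fun x' hx' =>
    ⟨fun y => M * J (x' - y) + (3 + ‖x‖) * (|f y| / (1 + ‖y‖)), ?_, ?_, ?_⟩⟩
  · exact ((hJint.comp_sub_left x').const_mul M).add (hf.integrable_div.const_mul _)
  · rw [integral_add ((hJint.comp_sub_left x').const_mul M) (hf.integrable_div.const_mul _),
      integral_const_mul, integral_const_mul, integral_sub_left_eq_self]
  · intro y hy p hp1 hp2
    have hpos : 0 < ‖x' - y‖ := norm_pos_iff.2 (sub_ne_zero.2 hy)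
    have hx'' : ‖x' - x‖ < 1 := by simpa [dist_eq_norm] using hx'
    have hJ0 : 0 ≤ J (x' - y) := by
      simp only [hJ]
      apply Set.indicator_apply_nonneg
      intro _
      positivity
    by_cases h1 : ‖x' - y‖ < 1
    · have hb : |f y| ≤ M := hM y (by
        rw [Metric.mem_closedBall, dist_eq_norm]
        have : y - x = (x' - x) - (x' - y) := by abel
        rw [this]
        linarith [norm_sub_le (x' - x) (x' - y)])
      have hJe : J (x' - y) = ‖x' - y‖ ^ (-(5 / 2) : ℝ) := by
        simp [hJ, Set.indicator, h1]
      have : ‖x' - y‖ ^ (-p) ≤ ‖x' - y‖ ^ (-(5 / 2) : ℝ) :=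
        Real.rpow_le_rpow_of_exponent_ge hpos h1.le (by linarith)
      have h0 : 0 ≤ (3 + ‖x‖) * (|f y| / (1 + ‖y‖)) := by positivity
      calc |f y| * ‖x' - y‖ ^ (-p) ≤ M * J (x' - y) := by rw [hJe]; gcongr
        _ ≤ _ := by linarith
    · push Not at h1
      have h2 : ‖x' - y‖ ^ (-p) ≤ ‖x' - y‖⁻¹ := by
        rw [← Real.rpow_neg_one]
        exact Real.rpow_le_rpow_of_exponent_le h1 (by linarith)
      have h3 : 1 + ‖y‖ ≤ (3 + ‖x‖) * ‖x' - y‖ := by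
        have : y = x + (x' - x) - (x' - y) := by abel
        have h4 : ‖y‖ ≤ ‖x‖ + ‖x' - x‖ + ‖x' - y‖ := by
          conv_lhs => rw [this]
          exact (norm_sub_le _ _).trans (by gcongr; exact norm_add_le _ _)
        nlinarith [norm_nonneg x]
      have h4 : ‖x' - y‖⁻¹ ≤ (3 + ‖x‖) / (1 + ‖y‖) := by
        rw [inv_eq_one_div, div_le_div_iff₀ hpos (by positivity)]
        linarith
      calc |f y| * ‖x' - y‖ ^ (-p) ≤ |f y| * ((3 + ‖x‖) / (1 + ‖y‖)) := by
            gcongr; exact h2.trans h4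
        _ = (3 + ‖x‖) * (|f y| / (1 + ‖y‖)) := by ring
        _ ≤ _ := by linarith [mul_nonneg hM0 hJ0]

theorem ae_ne (x : E3) : ∀ᵐ y : E3, x ≠ y := by
  have : ∀ᵐ y : E3, y ∉ ({x} : Set E3) := measure_eq_zero_iff_ae_notMem.1 (by simp)
  filter_upwards [this] with y hy h
  exact hy (by simp [h])

theorem integrable_rpow (hf : NewtonDensity f) (x : E3) {p : ℝ} (hp1 : 1 ≤ p) (hp2 : p ≤ 5 / 2) :
    Integrable (fun y => |f y| * ‖x - y‖ ^ (-p)) := by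
  obtain ⟨C, hC⟩ := hf.exists_rpow_bound x
  obtain ⟨g, hg, -, hb⟩ := hC x (by simp)
  refine hg.mono' ?_ ?_
  · have := hf.continuous.measurable
    exact Measurable.aestronglyMeasurable (by fun_prop)
  · filter_upwards [ae_ne x] with y hy
    rw [Real.norm_of_nonneg (by positivity)]
    exact hb y hy p hp1 hp2

theorem integrable_kernel (hf : NewtonDensity f) (x : E3) :
    Integrable (fun y => ‖x - y‖⁻¹ * f y) := by
  refine (hf.integrable_rpow x le_rfl (by norm_num)).mono' ?_ (.of_forall fun y => ?_)
  · have := hf.continuous.measurable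
    exact Measurable.aestronglyMeasurable (by fun_prop)
  · rw [Real.rpow_neg_one, norm_mul, norm_inv, norm_norm, Real.norm_eq_abs, mul_comm]

/-- The gradient of the Newtonian kernel in its first variable. -/
noncomputable def _root_.newtonGrad (z : E3) : E3 →L[ℝ] ℝ := (‖z‖⁻¹) ^ 3 • innerSL ℝ z

theorem _root_.norm_newtonGrad_le (z : E3) : ‖newtonGrad z‖ ≤ ‖z‖ ^ (-2 : ℝ) := by
  rcases eq_or_ne z 0 with rfl | hz
  · simp [newtonGrad]
  · have : 0 < ‖z‖ := norm_pos_iff.2 hz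
    rw [newtonGrad, norm_smul, innerSL_apply_norm, Real.rpow_neg this.le, norm_pow, norm_inv,
      norm_norm]
    norm_cast
    field_simp
    exact le_rfl

theorem _root_.measurable_newtonGrad : Measurable newtonGrad := by
  unfold newtonGrad
  have : Measurable fun z : E3 => innerSL ℝ z := (innerSL ℝ).continuous.measurable
  fun_prop

theorem integrable_grad (hf : NewtonDensity f) (x : E3) :
    Integrable (fun y => f y • newtonGrad (y - x)) := by
  refine (hf.integrable_rpow x (p := 2) (by norm_num) (by norm_num)).mono' ?_
    (.of_forall fun y => ?_)
  · have := hf.continuous.measurable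
    have := measurable_newtonGrad
    exact Measurable.aestronglyMeasurable (by fun_prop)
  · rw [norm_smul, Real.norm_eq_abs, norm_sub_rev x y]
    gcongr
    exact norm_newtonGrad_le _

/-- The Newtonian potential of an admissible density is differentiable. -/
theorem hasFDerivAt (hf : NewtonDensity f) (x : E3) :
    HasFDerivAt (fun x => ∫ y, ‖x - y‖⁻¹ * f y) (∫ y, f y • newtonGrad (y - x)) x := by
  obtain ⟨C, hC⟩ := hf.exists_rpow_bound x
  rw [hasFDerivAt_iff_isLittleO_nhds_zero]
  -- 12 = 3 · 2 · 2: the remainder bound, the interpolation, and the two centres x and x + h.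
  have main : ∀ h : E3, ‖h‖ < 1 →
      ‖(∫ y, ‖x + h - y‖⁻¹ * f y) - (∫ y, ‖x - y‖⁻¹ * f y) - (∫ y, f y • newtonGrad (y - x)) h‖ ≤
        12 * C * ‖h‖ ^ (3 / 2 : ℝ) := by
    intro h hh
    obtain ⟨g₁, hg₁, hi₁, hb₁⟩ := hC x (by simp)
    obtain ⟨g₂, hg₂, hi₂, hb₂⟩ := hC (x + h) (by simpa [dist_eq_norm] using hh)
    rw [ContinuousLinearMap.integral_apply (hf.integrable_grad x),
      ← integral_sub (hf.integrable_kernel _) (hf.integrable_kernel _), ← integral_sub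
      (by exact (hf.integrable_kernel _).sub (hf.integrable_kernel _))
      (by exact (hf.integrable_grad x).apply_continuousLinearMap h)]
    calc _ ≤ ∫ y, 6 * ‖h‖ ^ (3 / 2 : ℝ) * (g₁ y + g₂ y) := by
          refine norm_integral_le_of_norm_le ((hg₁.add hg₂).const_mul _) ?_
          filter_upwards [ae_ne x, ae_ne (x + h)] with y hy₁ hy₂
          have e : ‖x + h - y‖⁻¹ * f y - ‖x - y‖⁻¹ * f y - (f y • newtonGrad (y - x)) h =
              f y * (‖(x - y) + h‖⁻¹ - ‖x - y‖⁻¹ + inner ℝ (x - y) h * (‖x - y‖⁻¹) ^ 3) := by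
            rw [show x + h - y = x - y + h by abel, ← neg_sub x y]
            simp only [newtonGrad, norm_neg, smul_apply, innerSL_apply_apply,
              inner_neg_left, smul_eq_mul]
            ring
          have hyh : x - y + h ≠ 0 := by
            rw [sub_add_eq_add_sub]; exact sub_ne_zero.2 hy₂
          have h1 := abs_newton_remainder_le (x - y) h (sub_ne_zero.2 hy₁) hyh
          have h2 := newton_remainder_rpow_le (norm_pos_iff.2 (sub_ne_zero.2 hy₁))
            (norm_pos_iff.2 hyh) (norm_nonneg h) (by
              calc ‖h‖ = ‖(x - y + h) - (x - y)‖ := by congr 1; abel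
                _ ≤ _ := (norm_sub_le _ _).trans (by rw [add_comm]))
          have h3 := hb₁ y hy₁ (5 / 2) (by norm_num) le_rfl
          have h4 := hb₂ y hy₂ (5 / 2) (by norm_num) le_rfl
          rw [show x + h - y = x - y + h by abel] at h4
          rw [e, norm_mul, Real.norm_eq_abs, Real.norm_eq_abs]
          calc _ ≤ |f y| * (3 * (2 * ‖h‖ ^ (3 / 2 : ℝ) *
                (‖x - y‖ ^ (-(5 / 2) : ℝ) + ‖x - y + h‖ ^ (-(5 / 2) : ℝ)))) := by
                gcongr; linarith
            _ = 6 * ‖h‖ ^ (3 / 2 : ℝ) * (|f y| * ‖x - y‖ ^ (-(5 / 2) : ℝ) +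
                |f y| * ‖x - y + h‖ ^ (-(5 / 2) : ℝ)) := by ring
            _ ≤ _ := by gcongr
      _ = 6 * ‖h‖ ^ (3 / 2 : ℝ) * ((∫ y, g₁ y) + ∫ y, g₂ y) := by
          rw [integral_const_mul, integral_add hg₁ hg₂]
      _ ≤ 6 * ‖h‖ ^ (3 / 2 : ℝ) * (C + C) := by gcongr
      _ = _ := by ring
  refine (Asymptotics.IsBigO.of_bound (12 * C) (g := fun h : E3 => ‖h‖ ^ (3 / 2 : ℝ)) ?_).trans_isLittleO ?_
  · filter_upwards [Metric.ball_mem_nhds (0 : E3) one_pos] with h hh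
    rw [Real.norm_of_nonneg (show 0 ≤ ‖h‖ ^ (3 / 2 : ℝ) by positivity)]
    exact main h (by simpa using hh)
  · have h1 : (fun h : E3 => ‖h‖ ^ (1 / 2 : ℝ)) =o[𝓝 0] fun _ => (1 : ℝ) := by
      rw [Asymptotics.isLittleO_one_iff]
      have : Continuous fun h : E3 => ‖h‖ ^ (1 / 2 : ℝ) := by fun_prop (disch := norm_num)
      simpa using this.tendsto 0
    have h2 := h1.mul_isBigO (Asymptotics.isBigO_refl (fun h : E3 => ‖h‖) (𝓝 0))
    simp only [one_mul] at h2
    refine (h2.congr_left fun h => ?_).of_norm_right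
    rw [← Real.rpow_add_one' (norm_nonneg h) (by norm_num)]
    norm_num

end NewtonDensity

/-! ### Radial cutoffs of the kernel and their divergence. -/

/-- The profile `T (s / l² - 1) s^(-3/2)` of the Newtonian gradient cut off inside radius `l`. -/
noncomputable def cutProfile (l s : ℝ) : ℝ :=
  Real.smoothTransition (s / l ^ 2 - 1) * s ^ (-(3 / 2) : ℝ)

theorem cutProfile_eventuallyEq_zero {l s : ℝ} (hl : 0 < l) (hs : s < l ^ 2) :
    cutProfile l =ᶠ[𝓝 s] 0 := by
  filter_upwards [Iio_mem_nhds hs] with t ht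
  have : t / l ^ 2 - 1 ≤ 0 := by
    rw [sub_nonpos, div_le_one (by positivity)]; exact ht.le
  simp [cutProfile, Real.smoothTransition.zero_of_nonpos this]

theorem contDiff_cutProfile {l : ℝ} (hl : 0 < l) : ContDiff ℝ 1 (cutProfile l) := by
  rw [contDiff_iff_contDiffAt]
  intro s
  rcases lt_or_ge s (l ^ 2) with hs | hs
  · exact contDiffAt_const.congr_of_eventuallyEq (cutProfile_eventuallyEq_zero hl hs)
  · have hs0 : s ≠ 0 := ((by positivity : 0 < l ^ 2).trans_le hs).ne'
    refine ContDiffAt.mul ?_ (Real.contDiffAt_rpow_const_of_ne hs0)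
    exact Real.smoothTransition.contDiffAt.comp s (by fun_prop)

/-- The bump `2 T'(s - 1) s^(-1/2)`, as a function of the squared radius. -/
noncomputable def bump (s : ℝ) : ℝ :=
  2 * deriv Real.smoothTransition (s - 1) * s ^ (-(1 / 2) : ℝ)

theorem deriv_smoothTransition_of_nonpos {x : ℝ} (hx : x ≤ 0) :
    deriv Real.smoothTransition x = 0 := by
  rcases hx.lt_or_eq with hx | rfl
  · have : Real.smoothTransition =ᶠ[𝓝 x] fun _ => 0 := by
      filter_upwards [Iio_mem_nhds hx] with t ht
      exact Real.smoothTransition.zero_of_nonpos (le_of_lt ht)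
    rw [this.deriv_eq, deriv_const]
  · apply IsLocalMin.deriv_eq_zero
    filter_upwards with t
    rw [Real.smoothTransition.zero]
    exact Real.smoothTransition.nonneg t

theorem deriv_smoothTransition_of_one_le {x : ℝ} (hx : 1 ≤ x) :
    deriv Real.smoothTransition x = 0 := by
  apply IsLocalMax.deriv_eq_zero
  filter_upwards with t
  rw [Real.smoothTransition.one_of_one_le hx]
  exact Real.smoothTransition.le_one t

/-- The left side is the divergence of g(|z|²)z at s = |z|². The uncut profile s^{-3/2} is
divergence-free, so only the derivative of the cutoff contributes. -/
theorem cutProfile_div {l s : ℝ} (hl : 0 < l) :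
    3 * cutProfile l s + 2 * s * deriv (cutProfile l) s = (l⁻¹) ^ 3 * bump (s / l ^ 2) := by
  rcases lt_or_ge s (l ^ 2) with hs | hs
  · have h := cutProfile_eventuallyEq_zero hl hs
    have h1 : s / l ^ 2 - 1 ≤ 0 := by
      rw [sub_nonpos, div_le_one (by positivity)]; exact hs.le
    have h2 : deriv (cutProfile l) s = 0 := by
      rw [h.deriv_eq]; simp
    rw [h2, h.eq_of_nhds, bump, deriv_smoothTransition_of_nonpos h1]
    simp
  · have hs : 0 < s := (by positivity : 0 < l ^ 2).trans_le hs
    have hT : HasDerivAt (fun s : ℝ => Real.smoothTransition (s / l ^ 2 - 1))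
        (deriv Real.smoothTransition (s / l ^ 2 - 1) * (1 / l ^ 2)) s := by
      have h1 : HasDerivAt Real.smoothTransition _ (s / l ^ 2 - 1) :=
        ((Real.smoothTransition.contDiff (n := 1)).differentiable one_ne_zero _).hasDerivAt
      exact h1.comp s (((hasDerivAt_id s).div_const _).sub_const 1)
    have hd := (hT.mul (Real.hasDerivAt_rpow_const (p := -(3 / 2)) (Or.inl hs.ne'))).deriv
    have hd' : deriv (cutProfile l) s = _ := hd
    rw [hd', cutProfile, bump, Real.div_rpow hs.le (by positivity)]
    have e1 : (l ^ 2) ^ (-(1 / 2) : ℝ) = l⁻¹ := by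
      rw [← Real.rpow_natCast, ← Real.rpow_mul hl.le, ← Real.rpow_neg_one]; norm_num
    have e2 : s ^ (-(3 / 2) : ℝ) = s⁻¹ * s ^ (-(1 / 2) : ℝ) := by
      rw [← Real.rpow_neg_one s, ← Real.rpow_add hs]; norm_num
    have e3 : s ^ (-(3 / 2) - 1 : ℝ) = s⁻¹ * (s⁻¹ * s ^ (-(1 / 2) : ℝ)) := by
      rw [← Real.rpow_neg_one s, ← Real.rpow_add hs, ← Real.rpow_add hs]; norm_num
    rw [e1, e2, e3]
    field_simp
    ring

theorem bump_eq_zero {s : ℝ} (h : s ∉ Set.Ioo (1 : ℝ) 2) : bump s = 0 := by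
  have : deriv Real.smoothTransition (s - 1) = 0 := by
    rcases le_or_gt s 1 with h1 | h1
    · exact deriv_smoothTransition_of_nonpos (by linarith)
    · refine deriv_smoothTransition_of_one_le ?_
      by_contra! h2
      exact h ⟨h1, by linarith⟩
  simp [bump, this]

theorem continuous_bump_norm : Continuous fun z : E3 => bump (‖z‖ ^ 2) := by
  -- Rewriting the bump as a divergence at scale 1 avoids the singular factor s^{-1/2} at the
  -- origin.
  have h : ∀ z : E3, bump (‖z‖ ^ 2) =
      3 * cutProfile 1 (‖z‖ ^ 2) + 2 * ‖z‖ ^ 2 * deriv (cutProfile 1) (‖z‖ ^ 2) := fun z => by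
    rw [cutProfile_div one_pos]; simp
  simp_rw [h]
  have h1 := (contDiff_cutProfile one_pos).continuous
  have h2 := (contDiff_cutProfile one_pos).continuous_deriv le_rfl
  fun_prop

theorem hasCompactSupport_bump_norm : HasCompactSupport fun z : E3 => bump (‖z‖ ^ 2) := by
  refine HasCompactSupport.intro (isCompact_closedBall (0 : E3) 2) fun z hz => ?_
  apply bump_eq_zero
  intro h
  have : 2 < ‖z‖ := by simpa using hz
  nlinarith [h.2]

theorem integrable_bump_norm : Integrable fun z : E3 => bump (‖z‖ ^ 2) :=
  continuous_bump_norm.integrable_of_hasCompactSupport hasCompactSupport_bump_norm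

/-- In polar coordinates the radial integrand r² · `bump` (r²) is the exact derivative of T(r² - 1),
whose total increase is 1. -/
theorem integral_bump_norm : ∫ z : E3, bump (‖z‖ ^ 2) = 4 * Real.pi := by
  rw [integral_norm_E3 fun r => bump (r ^ 2)]
  -- Subtracting 1 gives this primitive compact support.
  have hc : ContDiff ℝ 1 fun r : ℝ => Real.smoothTransition (r ^ 2 - 1) - 1 :=
    (Real.smoothTransition.contDiff.comp (by fun_prop)).sub contDiff_const
  have hs : HasCompactSupport fun r : ℝ => Real.smoothTransition (r ^ 2 - 1) - 1 := by
    refine HasCompactSupport.intro (isCompact_closedBall (0 : ℝ) 2) fun z hz => ?_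
    have : 2 < |z| := by simpa using hz
    rw [Real.smoothTransition.one_of_one_le, sub_self]
    rw [← sq_abs]
    nlinarith
  have h := hs.integral_Ioi_deriv_eq hc 0
  rw [Real.smoothTransition.zero_of_nonpos (by norm_num)] at h
  have e : ∫ r in Set.Ioi (0 : ℝ), r ^ 2 * bump (r ^ 2) =
      ∫ r in Set.Ioi (0 : ℝ), deriv (fun r : ℝ => Real.smoothTransition (r ^ 2 - 1) - 1) r := by
    refine setIntegral_congr_fun measurableSet_Ioi fun r hr => ?_
    have hr : (0 : ℝ) < r := hr
    have h1 : HasDerivAt Real.smoothTransition _ (r ^ 2 - 1) :=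
      ((Real.smoothTransition.contDiff (n := 1)).differentiable one_ne_zero _).hasDerivAt
    have h2 := (h1.comp r (((hasDerivAt_pow 2 r).sub_const 1))).sub_const 1
    have h3 : deriv (fun r : ℝ => Real.smoothTransition (r ^ 2 - 1) - 1) r = _ := h2.deriv
    have h4 : (r ^ 2) ^ (-(1 / 2) : ℝ) = r⁻¹ := by
      rw [← Real.rpow_natCast, ← Real.rpow_mul hr.le, ← Real.rpow_neg_one]; norm_num
    simp only [h3, bump, h4]
    field_simp
    push_cast
    ring
  rw [e, h]
  ring

theorem integral_scaled_bump {l : ℝ} (hl : 0 < l) (b : E3 → ℝ) (x : E3) :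
    ∫ z : E3, (l⁻¹) ^ 3 * bump (‖z‖ ^ 2 / l ^ 2) * b (x + z) =
      ∫ z : E3, bump (‖z‖ ^ 2) * b (x + l • z) := by
  have h := Measure.integral_comp_smul (volume : Measure E3)
    (fun z : E3 => bump (‖z‖ ^ 2 / l ^ 2) * b (x + z)) l
  have e : ∀ z : E3, ‖l • z‖ ^ 2 / l ^ 2 = ‖z‖ ^ 2 := fun z => by
    rw [norm_smul, Real.norm_of_nonneg hl.le]; field_simp
  simp only [e] at h
  rw [h]
  simp only [mul_assoc, integral_const_mul]
  rw [abs_of_pos (by positivity)]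
  simp

/-- A sequence of averages against scaled bumps, by dominated convergence. -/
theorem tendsto_integral_bump {ι : Type*} {F : Filter ι} [F.IsCountablyGenerated]
    {b : E3 → ℝ} (hb : Continuous b)
    {M : ℝ} (hM : ∀ x, |b x| ≤ M) (x : E3) (l : ι → ℝ) (c : ℝ)
    (hl : ∀ z : E3, z ≠ 0 → Tendsto (fun n => b (x + l n • z)) F (𝓝 c)) :
    Tendsto (fun n => ∫ z : E3, bump (‖z‖ ^ 2) * b (x + l n • z)) F (𝓝 (4 * Real.pi * c)) := by
  rw [← integral_bump_norm, ← integral_mul_const]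
  refine tendsto_integral_filter_of_dominated_convergence
    (fun z : E3 => |bump (‖z‖ ^ 2)| * M) ?_ ?_ ?_ ?_
  · refine .of_forall fun n => Continuous.aestronglyMeasurable ?_
    exact continuous_bump_norm.mul (hb.comp (by fun_prop))
  · refine .of_forall fun n => .of_forall fun z => ?_
    rw [norm_mul, Real.norm_eq_abs, Real.norm_eq_abs]
    gcongr
    exact hM _
  · exact integrable_bump_norm.abs.mul_const M
  · filter_upwards [NewtonDensity.ae_ne 0] with z hz
    exact (hl z hz.symm).const_mul _

/-! ### Integration by parts against radial fields. -/

/-- Integrable functions with vanishing integral. -/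
def ZeroIntegral (f : E3 → ℝ) : Prop := Integrable f ∧ ∫ z, f z = 0

theorem ZeroIntegral.add {f g : E3 → ℝ} (hf : ZeroIntegral f) (hg : ZeroIntegral g) :
    ZeroIntegral fun z => f z + g z :=
  ⟨hf.1.add hg.1, by rw [integral_add hf.1 hg.1, hf.2, hg.2, add_zero]⟩

theorem ZeroIntegral.sub {f g : E3 → ℝ} (hf : ZeroIntegral f) (hg : ZeroIntegral g) :
    ZeroIntegral fun z => f z - g z :=
  ⟨hf.1.sub hg.1, by rw [integral_sub hf.1 hg.1, hf.2, hg.2, sub_zero]⟩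

section RadialField

variable {g : ℝ → ℝ} {R : ℝ} {b : E3 → ℝ}

theorem contDiff_radialField (hg : ContDiff ℝ 1 g) (j : Fin 3) :
    ContDiff ℝ 1 fun z : E3 => g (‖z‖ ^ 2) * z j := by
  have h1 : ContDiff ℝ 1 fun z : E3 => ‖z‖ ^ 2 := contDiff_norm_sq ℝ
  have h2 : ContDiff ℝ 1 fun z : E3 => z j := (EuclideanSpace.proj (𝕜 := ℝ) j).contDiff
  exact (hg.comp h1).mul h2

theorem hasCompactSupport_radialField (hR : ∀ s, R ^ 2 < s → g s = 0) (hR0 : 0 ≤ R) (j : Fin 3) :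
    HasCompactSupport fun z : E3 => g (‖z‖ ^ 2) * z j := by
  refine HasCompactSupport.intro (isCompact_closedBall (0 : E3) R) fun z hz => ?_
  have : R < ‖z‖ := by simpa using hz
  rw [hR _ (by gcongr), zero_mul]

theorem fderiv_radialField (hg : ContDiff ℝ 1 g) (i j : Fin 3) (z : E3) :
    fderiv ℝ (fun z : E3 => g (‖z‖ ^ 2) * z j) z (cartVec i) =
      g (‖z‖ ^ 2) * (if j = i then 1 else 0) + 2 * z i * z j * deriv g (‖z‖ ^ 2) := by
  have h1 : HasFDerivAt (fun z : E3 => ‖z‖ ^ 2) (2 • innerSL ℝ z) z :=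
    (hasStrictFDerivAt_norm_sq z).hasFDerivAt
  have h2 : HasFDerivAt (fun z : E3 => z j) (EuclideanSpace.proj (𝕜 := ℝ) j) z :=
    (EuclideanSpace.proj (𝕜 := ℝ) j).hasFDerivAt
  have h3 := ((hg.differentiable one_ne_zero (‖z‖ ^ 2)).hasDerivAt.comp_hasFDerivAt z h1).mul h2
  have h4 : fderiv ℝ (fun z : E3 => g (‖z‖ ^ 2) * z j) z = _ := h3.fderiv
  rw [h4]
  simp [cartVec, EuclideanSpace.inner_single_right]
  ring

theorem zeroIntegral_radialField (hg : ContDiff ℝ 1 g) (hR : ∀ s, R ^ 2 < s → g s = 0)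
    (hR0 : 0 ≤ R) (hb : ContDiff ℝ 1 b) (x : E3) (i j : Fin 3) :
    ZeroIntegral fun z => g (‖z‖ ^ 2) * z j * fderiv ℝ b (x + z) (cartVec i) +
      (g (‖z‖ ^ 2) * (if j = i then 1 else 0) + 2 * z i * z j * deriv g (‖z‖ ^ 2)) * b (x + z) := by
  have hk := contDiff_radialField hg j
  have hs := hasCompactSupport_radialField hR hR0 j
  have hb' : ContDiff ℝ 1 fun z => b (x + z) := hb.comp (by fun_prop)
  have e : ∀ z, fderiv ℝ b (x + z) = fderiv ℝ (fun z => b (x + z)) z := fun z => by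
    rw [fderiv_comp_add_left]
  simp_rw [e, ← fderiv_radialField hg]
  have i1 : Integrable fun z : E3 => g (‖z‖ ^ 2) * z j *
      fderiv ℝ (fun z => b (x + z)) z (cartVec i) := by
    refine Continuous.integrable_of_hasCompactSupport (hk.continuous.mul ?_) hs.mul_right
    exact (hb'.continuous_fderiv one_ne_zero).clm_apply continuous_const
  have i2 : Integrable fun z : E3 => fderiv ℝ (fun z : E3 => g (‖z‖ ^ 2) * z j) z (cartVec i) *
      b (x + z) := by
    refine Continuous.integrable_of_hasCompactSupport (.mul ?_ hb'.continuous)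
      (hs.fderiv_apply ℝ _).mul_right
    exact (hk.continuous_fderiv one_ne_zero).clm_apply continuous_const
  refine ⟨i1.add i2, ?_⟩
  rw [integral_add i1 i2, integral_mul_fderiv_eq_neg_fderiv_mul_of_integrable i2 i1
    ((hk.continuous.mul hb'.continuous).integrable_of_hasCompactSupport hs.mul_right)
    (fun z _ => hk.differentiable one_ne_zero z) (fun z _ => hb'.differentiable one_ne_zero z)]
  exact neg_add_cancel _

/-- Integration by parts of the Helmholtz integrand against a radial (hence curl-free) field. -/
theorem zeroIntegral_helmholtz (hg : ContDiff ℝ 1 g) (hR : ∀ s, R ^ 2 < s → g s = 0)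
    (hR0 : 0 ≤ R) {B : Fin 3 → E3 → ℝ} (hB : ∀ i, ContDiff ℝ 1 (B i)) (x : E3) {p q r : Fin 3}
    (hpr : p ≠ r) (hqr : q ≠ r) (hsum : ∀ f : Fin 3 → ℝ, ∑ i, f i = f p + f q + f r) :
    ZeroIntegral fun z => g (‖z‖ ^ 2) *
      (z p * (fderiv ℝ (B r) (x + z) (cartVec p) - fderiv ℝ (B p) (x + z) (cartVec r)) +
      z q * (fderiv ℝ (B r) (x + z) (cartVec q) - fderiv ℝ (B q) (x + z) (cartVec r)) +
      z r * ∑ i, fderiv ℝ (B i) (x + z) (cartVec i)) +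
      (3 * g (‖z‖ ^ 2) + 2 * ‖z‖ ^ 2 * deriv g (‖z‖ ^ 2)) * B r (x + z) := by
  have G := fun i j m => zeroIntegral_radialField hg hR hR0 (hB m) x i j
  -- In `G i j m` component j of the field meets ∂_i of B_m. The pairs `G p r p` - `G r p p` and `G
  -- q r q` - `G r q q` lose their zeroth-order terms because the field is curl-free; the three
  -- diagonal terms give the divergence.
  have := ((((((G p p r).sub (G r p p)).add (G q q r)).sub (G r q q)).add (G p r p)).add
    (G q r q)).add (G r r r)
  convert this using 2 with z
  have hz : ‖z‖ ^ 2 = z p ^ 2 + z q ^ 2 + z r ^ 2 := by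
    rw [EuclideanSpace.norm_sq_eq, ← hsum fun i => z i ^ 2]; simp
  simp only [hsum, hpr, hqr, hpr.symm, hqr.symm, if_true, if_false]
  generalize deriv g (‖z‖ ^ 2) = g' at *
  generalize g (‖z‖ ^ 2) = g0 at *
  rw [hz]
  ring

end RadialField

/-! ### Removing the cutoffs. -/

/-- The annular cutoff equal to one for `√2 ε ≤ ‖z‖ ≤ R`. -/
noncomputable def annulus (ε R : ℝ) (z : E3) : ℝ :=
  Real.smoothTransition (‖z‖ ^ 2 / ε ^ 2 - 1) - Real.smoothTransition (‖z‖ ^ 2 / R ^ 2 - 1)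

theorem abs_annulus_le (ε R : ℝ) (z : E3) : |annulus ε R z| ≤ 1 := by
  unfold annulus
  rw [abs_le]
  constructor <;> linarith [Real.smoothTransition.le_one (‖z‖ ^ 2 / ε ^ 2 - 1),
    Real.smoothTransition.le_one (‖z‖ ^ 2 / R ^ 2 - 1),
    Real.smoothTransition.nonneg (‖z‖ ^ 2 / ε ^ 2 - 1),
    Real.smoothTransition.nonneg (‖z‖ ^ 2 / R ^ 2 - 1)]

theorem continuous_annulus (ε R : ℝ) : Continuous (annulus ε R) := by
  have := Real.smoothTransition.continuous
  unfold annulus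
  fun_prop

theorem cutProfile_sub_cutProfile (ε R : ℝ) (z : E3) :
    cutProfile ε (‖z‖ ^ 2) - cutProfile R (‖z‖ ^ 2) = annulus ε R z * (‖z‖⁻¹) ^ 3 := by
  have h : (‖z‖ ^ 2) ^ (-(3 / 2) : ℝ) = (‖z‖⁻¹) ^ 3 := by
    rw [← Real.rpow_natCast, ← Real.rpow_mul (norm_nonneg z), ← Real.rpow_natCast,
      Real.inv_rpow (norm_nonneg z), ← Real.rpow_neg (norm_nonneg z)]
    norm_num
  rw [cutProfile, cutProfile, annulus, h]
  ring

theorem tendsto_annulus {z : E3} (hz : z ≠ 0) :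
    Tendsto (fun n : ℕ => annulus ((n : ℝ) + 1)⁻¹ ((n : ℝ) + 1) z) atTop (𝓝 1) := by
  have hz : 0 < ‖z‖ := norm_pos_iff.2 hz
  have hL : Tendsto (fun n : ℕ => (n : ℝ) + 1) atTop atTop :=
    tendsto_atTop_add_const_right _ _ tendsto_natCast_atTop_atTop
  refine tendsto_const_nhds.congr' ?_
  filter_upwards [hL.eventually_ge_atTop ‖z‖, hL.eventually_ge_atTop (2 / ‖z‖)] with n h1 h2
  rw [div_le_iff₀ hz] at h2
  have hn : 0 < (n : ℝ) + 1 := by positivity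
  rw [annulus, Real.smoothTransition.one_of_one_le, Real.smoothTransition.zero_of_nonpos, sub_zero]
  · rw [sub_nonpos, div_le_one (by positivity)]
    gcongr
  · rw [inv_pow, div_inv_eq_mul, ← mul_pow, mul_comm ‖z‖]
    nlinarith

theorem exists_abs_le_of_tendsto_zero {b : E3 → ℝ} (hb : Continuous b)
    (h0 : Tendsto b (cocompact E3) (𝓝 0)) : ∃ M, ∀ x, |b x| ≤ M := by
  let f : ZeroAtInftyContinuousMap E3 ℝ := ⟨⟨b, hb⟩, h0⟩
  exact ⟨‖f.toBCF‖, fun x => f.toBCF.norm_coe_le_norm x⟩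

/-- One component of the Helmholtz decomposition of a vector field. -/
theorem helmholtz_component {B : Fin 3 → E3 → ℝ} (hB : ∀ i, ContDiff ℝ 1 (B i)) {p q r : Fin 3}
    (h0 : Tendsto (B r) (cocompact E3) (𝓝 0))
    (hpr : p ≠ r) (hqr : q ≠ r) (hsum : ∀ f : Fin 3 → ℝ, ∑ i, f i = f p + f q + f r)
    {D P Q : E3 → ℝ} (hD : NewtonDensity D) (hP : NewtonDensity P) (hQ : NewtonDensity Q)
    (eD : ∀ y, D y = ∑ i, fderiv ℝ (B i) y (cartVec i))
    (eP : ∀ y, P y = fderiv ℝ (B r) y (cartVec p) - fderiv ℝ (B p) y (cartVec r))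
    (eQ : ∀ y, Q y = fderiv ℝ (B r) y (cartVec q) - fderiv ℝ (B q) y (cartVec r)) (x : E3) :
    (∫ y, P y • newtonGrad (y - x)) (cartVec p) + (∫ y, Q y • newtonGrad (y - x)) (cartVec q) +
      (∫ y, D y • newtonGrad (y - x)) (cartVec r) = -(4 * Real.pi * B r x) := by
  have iP : Integrable fun y => (P y • newtonGrad (y - x)) (cartVec p) :=
    (hP.integrable_grad x).apply_continuousLinearMap _
  have iQ : Integrable fun y => (Q y • newtonGrad (y - x)) (cartVec q) :=
    (hQ.integrable_grad x).apply_continuousLinearMap _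
  have iD : Integrable fun y => (D y • newtonGrad (y - x)) (cartVec r) :=
    (hD.integrable_grad x).apply_continuousLinearMap _
  set H : E3 → ℝ := fun y => (P y • newtonGrad (y - x)) (cartVec p) +
    (Q y • newtonGrad (y - x)) (cartVec q) + (D y • newtonGrad (y - x)) (cartVec r) with hH
  have iH : Integrable H := (iP.add iQ).add iD
  have iH' : Integrable fun z => H (x + z) := iH.comp_add_left x
  have eH : ∀ z, H (x + z) = (‖z‖⁻¹) ^ 3 *
      (z p * (fderiv ℝ (B r) (x + z) (cartVec p) - fderiv ℝ (B p) (x + z) (cartVec r)) +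
      z q * (fderiv ℝ (B r) (x + z) (cartVec q) - fderiv ℝ (B q) (x + z) (cartVec r)) +
      z r * ∑ i, fderiv ℝ (B i) (x + z) (cartVec i)) := fun z => by
    simp only [hH, eP, eQ, eD, newtonGrad, smul_apply, smul_eq_mul, innerSL_apply_apply, cartVec,
      EuclideanSpace.inner_single_right, add_sub_cancel_left]
    simp
    ring
  have lhs : (∫ y, P y • newtonGrad (y - x)) (cartVec p) +
      (∫ y, Q y • newtonGrad (y - x)) (cartVec q) +
      (∫ y, D y • newtonGrad (y - x)) (cartVec r) = ∫ z, H (x + z) := by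
    rw [integral_add_left_eq_self H x, ContinuousLinearMap.integral_apply (hP.integrable_grad x),
      ContinuousLinearMap.integral_apply (hQ.integrable_grad x),
      ContinuousLinearMap.integral_apply (hD.integrable_grad x), hH,
      integral_add (by exact iP.add iQ) iD, integral_add iP iQ]
  rw [lhs]
  obtain ⟨M, hM⟩ := exists_abs_le_of_tendsto_zero (hB r).continuous h0
  set L : ℕ → ℝ := fun n => (n : ℝ) + 1 with hL
  have hLpos : ∀ n, 0 < L n := fun n => by positivity
  have hLtop : Tendsto L atTop atTop :=
    tendsto_atTop_add_const_right _ _ tendsto_natCast_atTop_atTop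
  -- The full integrand is absolutely integrable, so the cutoff may be removed by dominated
  -- convergence.
  have t1 : Tendsto (fun n => ∫ z, annulus (L n)⁻¹ (L n) z * H (x + z)) atTop
      (𝓝 (∫ z, H (x + z))) := by
    refine tendsto_integral_of_dominated_convergence (fun z => |H (x + z)|) (fun n => ?_)
      iH'.abs (fun n => .of_forall fun z => ?_) ?_
    · exact (continuous_annulus _ _).aestronglyMeasurable.mul iH'.aestronglyMeasurable
    · rw [norm_mul, Real.norm_eq_abs, Real.norm_eq_abs]
      exact mul_le_of_le_one_left (abs_nonneg _) (abs_annulus_le _ _ _)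
    · filter_upwards [NewtonDensity.ae_ne 0] with z hz
      simpa using (tendsto_annulus hz.symm).mul_const (H (x + z))
  have t2 : Tendsto (fun n => ∫ z, bump (‖z‖ ^ 2) * B r (x + (L n)⁻¹ • z)) atTop
      (𝓝 (4 * Real.pi * B r x)) := by
    refine tendsto_integral_bump (hB r).continuous hM x _ _ fun z _ => ?_
    have h1 : Tendsto (fun n => x + (L n)⁻¹ • z) atTop (𝓝 (x + (0 : ℝ) • z)) :=
      ((tendsto_inv_atTop_zero.comp hLtop).smul_const z).const_add x
    rw [zero_smul, add_zero] at h1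
    exact ((hB r).continuous.tendsto x).comp h1
  -- For z ≠ 0 the points x + L z leave every compact set; this is where decay of B_r kills the
  -- outer average.
  have t3 : Tendsto (fun n => ∫ z, bump (‖z‖ ^ 2) * B r (x + L n • z)) atTop
      (𝓝 (4 * Real.pi * 0)) := by
    refine tendsto_integral_bump (hB r).continuous hM x _ _ fun z hz => h0.comp ?_
    rw [← Metric.cobounded_eq_cocompact, ← tendsto_norm_atTop_iff_cobounded]
    refine tendsto_atTop_mono (f := fun n => L n * ‖z‖ - ‖x‖) (fun n => ?_) ?_
    · have h1 : L n • z = (x + L n • z) - x := by abel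
      have h2 := norm_sub_le (x + L n • z) x
      rw [← h1, norm_smul, Real.norm_of_nonneg (hLpos n).le] at h2
      linarith
    · exact tendsto_atTop_add_const_right _ _ (hLtop.atTop_mul_const (norm_pos_iff.2 hz))
  have key : ∀ n, ∫ z, annulus (L n)⁻¹ (L n) z * H (x + z) =
      -((∫ z, bump (‖z‖ ^ 2) * B r (x + (L n)⁻¹ • z)) -
        ∫ z, bump (‖z‖ ^ 2) * B r (x + L n • z)) := by
    intro n
    have hε : 0 < (L n)⁻¹ := inv_pos.2 (hLpos n)
    have h1 : 1 ≤ L n := by simp [hL]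
    have hε1 : (L n)⁻¹ ≤ 1 := inv_le_one_of_one_le₀ h1
    have c1 := contDiff_cutProfile hε
    have c2 := contDiff_cutProfile (hLpos n)
    have hsupp : ∀ s, (2 * L n) ^ 2 < s →
        (fun s => cutProfile (L n)⁻¹ s - cutProfile (L n) s) s = 0 := by
      intro s hs
      have hs1 : (2 : ℝ) ≤ s := by nlinarith
      simp only [cutProfile]
      rw [Real.smoothTransition.one_of_one_le, Real.smoothTransition.one_of_one_le, sub_self]
      · rw [le_sub_iff_add_le, le_div_iff₀ (by positivity)]; nlinarith
      · rw [le_sub_iff_add_le, le_div_iff₀ (by positivity)]; nlinarith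
    have hz := zeroIntegral_helmholtz (c1.sub c2) hsupp (by positivity) hB x hpr hqr hsum
    have ed : ∀ s, deriv (fun s => cutProfile (L n)⁻¹ s - cutProfile (L n) s) s =
        deriv (cutProfile (L n)⁻¹) s - deriv (cutProfile (L n)) s := fun s =>
      deriv_fun_sub (c1.differentiable one_ne_zero s) (c2.differentiable one_ne_zero s)
    have ib : ∀ l : ℝ, 0 < l →
        Integrable fun z : E3 => (l⁻¹) ^ 3 * bump (‖z‖ ^ 2 / l ^ 2) * B r (x + z) := by
      intro l hl
      have e : ∀ z : E3, ‖z‖ ^ 2 / l ^ 2 = ‖l⁻¹ • z‖ ^ 2 := fun z => by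
        rw [norm_smul, norm_inv, Real.norm_of_nonneg hl.le]; field_simp
      simp_rw [e]
      refine Continuous.integrable_of_hasCompactSupport ?_ (HasCompactSupport.mul_right
        (HasCompactSupport.mul_left
          (hasCompactSupport_bump_norm.comp_smul (inv_ne_zero hl.ne'))))
      exact (continuous_const.mul (continuous_bump_norm.comp (continuous_const_smul _))).mul
        ((hB r).continuous.comp (by fun_prop))
    have e : ∀ z : E3, annulus (L n)⁻¹ (L n) z * H (x + z) +
        ((((L n)⁻¹)⁻¹) ^ 3 * bump (‖z‖ ^ 2 / (L n)⁻¹ ^ 2) * B r (x + z) -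
          ((L n)⁻¹) ^ 3 * bump (‖z‖ ^ 2 / L n ^ 2) * B r (x + z)) = _ := fun z => by
      rw [eH, ← mul_assoc, ← cutProfile_sub_cutProfile, ← cutProfile_div hε,
        ← cutProfile_div (hLpos n)]
    have hz2 := hz.2
    simp_rw [ed] at hz2
    rw [← integral_scaled_bump hε, ← integral_scaled_bump (hLpos n),
      ← integral_sub (ib _ hε) (ib _ (hLpos n)), eq_neg_iff_add_eq_zero, ← integral_add]
    · rw [← hz2]
      refine integral_congr_ae (.of_forall fun z => ?_)
      simp only [e]
      ring
    · refine iH'.bdd_mul (continuous_annulus _ _).aestronglyMeasurable (c := 1)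
        (.of_forall fun z => abs_annulus_le _ _ z)
    · exact (ib _ hε).sub (ib _ (hLpos n))
  simp_rw [key] at t1
  have := tendsto_nhds_unique t1 (t2.sub t3).neg
  rw [this]
  ring

/-! ### From forms to components, and the theorem. -/

theorem NewtonDensity.neg {f : E3 → ℝ} (hf : NewtonDensity f) : NewtonDensity fun y => -f y :=
  ⟨hf.continuous.neg, by simpa using hf.integrable_div⟩

theorem NewtonDensity.of_form {k : ℕ} {η : E3 → E3Form k} (v : Fin k → Fin 3)
    (hc : Continuous fun y => η y fun i => cartVec (v i))
    (hη : Integrable fun y => ‖η y‖ / (1 + ‖y‖)) :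
    NewtonDensity fun y => η y fun i => cartVec (v i) := by
  refine ⟨hc, hη.mono' ?_ (.of_forall fun y => ?_)⟩
  · exact Continuous.aestronglyMeasurable
      (hc.abs.div (by fun_prop) fun y => by positivity)
  · rw [Real.norm_of_nonneg (by positivity), ← Real.norm_eq_abs]
    gcongr
    simpa using (η y).le_opNorm fun i => cartVec (v i)

section Components

variable {β : E3 → E3Form 2}

theorem intDeriv_cartVec (y : E3) (m : Fin 3) :
    intDeriv β y ![cartVec m] = ∑ h, fderiv ℝ β y (cartVec h) ![cartVec h, cartVec m] := by
  simp [intDeriv]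

theorem extDeriv_cartVec (y : E3) : extDeriv β y cartVec =
    ∑ i, fderiv ℝ β y (cartVec i) ![cartVec (i + 1), cartVec (i + 2)] := by
  rw [extDeriv, ContinuousAlternatingMap.alternatizeUncurryFin_apply]
  have h1 : Fin.removeNth 0 cartVec = ![cartVec 1, cartVec 2] := by
    ext k; fin_cases k <;> rfl
  have h2 : Fin.removeNth 1 cartVec = ![cartVec 0, cartVec 2] := by
    ext k; fin_cases k <;> rfl
  have h3 : Fin.removeNth 2 cartVec = ![cartVec 0, cartVec 1] := by
    ext k; fin_cases k <;> rfl
  refine (Fin.sum_univ_three _).trans ?_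
  rw [h1, h2, h3, Fin.sum_univ_three, E3Form.two_swap _ (cartVec 0) (cartVec 2)]
  simp

theorem continuous_fderiv_form (hβ : ContDiff ℝ 1 β) (u : E3) (v : Fin 2 → E3) :
    Continuous fun y => fderiv ℝ β y u v := by
  have h : Continuous fun y => fderiv ℝ β y u :=
    (hβ.continuous_fderiv one_ne_zero).clm_apply continuous_const
  exact (ContinuousAlternatingMap.apply ℝ E3 ℝ v).continuous.comp h

theorem formIntegral_deltaIntegrand (i : Fin 3) (x : E3) :
    formIntegral (deltaIntegrand β i x) = ∫ y, ‖x - y‖⁻¹ * intDeriv β y ![cartVec i] := by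
  unfold formIntegral deltaIntegrand
  refine integral_congr_ae (.of_forall fun y => ?_)
  exact congrArg (‖x - y‖⁻¹ * ·) (wedge_dx_dx_cartVec (intDeriv β y) i)

theorem formIntegral_dIntegrand (x : E3) :
    formIntegral (dIntegrand β x) = ∫ y, ‖x - y‖⁻¹ * extDeriv β y cartVec := by
  unfold formIntegral dIntegrand
  refine integral_congr_ae (.of_forall fun y => ?_)
  exact congrArg (‖x - y‖⁻¹ * ·) (wedge_oneForm0_cartVec (extDeriv β y))

theorem deltaIntegrand_eq (i : Fin 3) (x y : E3) : deltaIntegrand β i x y =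
    (‖x - y‖⁻¹ * intDeriv β y ![cartVec i]) • unitForm := by
  rw [E3Form.eq_smul_unitForm (deltaIntegrand β i x y)]
  congr 1
  exact congrArg (‖x - y‖⁻¹ * ·) (wedge_dx_dx_cartVec (intDeriv β y) i)

theorem dIntegrand_eq (x y : E3) : dIntegrand β x y =
    (‖x - y‖⁻¹ * extDeriv β y cartVec) • unitForm := by
  rw [E3Form.eq_smul_unitForm (dIntegrand β x y)]
  congr 1
  exact congrArg (‖x - y‖⁻¹ * ·) (wedge_oneForm0_cartVec (extDeriv β y))

end Components

theorem extDeriv_sum_smul_dx {g : Fin 3 → E3 → ℝ} {g' : Fin 3 → E3 →L[ℝ] ℝ} {x : E3}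
    (hg : ∀ i, HasFDerivAt (g i) (g' i) x) (p q : Fin 3) :
    extDeriv (fun x => ∑ i, g i x • dx i) x ![cartVec p, cartVec q] =
      g' q (cartVec p) - g' p (cartVec q) := by
  have h : HasFDerivAt (fun x => ∑ i, g i x • dx i) (∑ i, (g' i).smulRight (dx i)) x :=
    HasFDerivAt.fun_sum fun i _ => (hg i).smul_const (dx i)
  rw [extDeriv, ContinuousAlternatingMap.alternatizeUncurryFin_apply, h.fderiv]
  simp [Fin.sum_univ_two, Fin.removeNth, sub_eq_add_neg]

/-- Contraction leaves w(e_h, e_{r+1}, e_{r+2}), which is 1 for h = r, a cyclic and hence even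
arrangement, and 0 otherwise by a repeated vector. -/
theorem intDeriv_smul_unitForm {g : E3 → ℝ} {g' : E3 →L[ℝ] ℝ} {x : E3}
    (hg : HasFDerivAt g g' x) (r : Fin 3) :
    intDeriv (fun x => g x • unitForm) x ![cartVec (r + 1), cartVec (r + 2)] =
      g' (cartVec r) := by
  have h := hg.smul_const unitForm
  simp only [intDeriv, h.fderiv, ContinuousLinearMap.smulRight_apply]
  have hu : ∀ h : Fin 3, unitForm ![cartVec h, cartVec (r + 1), cartVec (r + 2)] =
      if h = r then 1 else 0 := by
    intro h
    split_ifs with hh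
    · subst hh
      have : ![cartVec h, cartVec (h + 1), cartVec (h + 2)] = cartVec ∘ Equiv.addLeft h := by
        ext k; fin_cases k <;> simp
      rw [this]
      have h1 : unitForm (cartVec ∘ Equiv.addLeft h) =
        Equiv.Perm.sign (Equiv.addLeft h) • unitForm cartVec := unitForm.map_perm cartVec _
      have h2 : ∀ h : Fin 3, Equiv.Perm.sign (Equiv.addLeft h) = 1 := by decide
      rw [h1, h2, unitForm_cartVec, one_smul]
    · have h1 : ∀ r h : Fin 3, h ≠ r → h = r + 1 ∨ h = r + 2 := by decide
      rcases h1 r h hh with rfl | rfl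
      · exact unitForm.map_eq_zero_of_eq _ (i := 0) (j := 1) (by simp) (by simp)
      · exact unitForm.map_eq_zero_of_eq _ (i := 0) (j := 2) (by simp) (by simp)
  simp [hu]

/-- Helmholtz theorem for differential `2`-forms in Euclidean three-space. -/
theorem mainTheorem6 (β : E3 → E3Form 2) (hβ : ContDiff ℝ 1 β)
    (hβ_inf : Filter.Tendsto β (Filter.cocompact E3) (𝓝 0))
    (hd_inf : MeasureTheory.Integrable (fun y : E3 => ‖extDeriv β y‖ / (1 + ‖y‖)))
    (hδ_inf : MeasureTheory.Integrable (fun y : E3 => ‖intDeriv β y‖ / (1 + ‖y‖))) :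
    (∀ (i : Fin 3) (x : E3), MeasureTheory.Integrable (deltaIntegrand β i x)) ∧
    (∀ x : E3, MeasureTheory.Integrable (dIntegrand β x)) ∧
    Differentiable ℝ (deltaPotential β) ∧
    Differentiable ℝ (dPotential β) ∧
    ∀ x : E3, β x =
      -(1 / (4 * Real.pi)) • extDeriv (deltaPotential β) x
        - (1 / (4 * Real.pi)) • intDeriv (dPotential β) x := by
  have hD : NewtonDensity fun y => extDeriv β y cartVec := by
    refine NewtonDensity.of_form id ?_ hd_inf
    change Continuous fun y => extDeriv β y cartVec
    simp_rw [extDeriv_cartVec]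
    exact continuous_finsetSum _ fun i _ => continuous_fderiv_form hβ _ _
  have hC : ∀ m : Fin 3, NewtonDensity fun y => intDeriv β y ![cartVec m] := by
    intro m
    have e : ![cartVec m] = fun i => cartVec (![m] i) := by
      ext k; fin_cases k; rfl
    rw [e]
    refine NewtonDensity.of_form _ ?_ hδ_inf
    rw [← e]
    simp_rw [intDeriv_cartVec]
    exact continuous_finsetSum _ fun i _ => continuous_fderiv_form hβ _ _
  have hδP : deltaPotential β =
      fun x => ∑ i, (∫ y, ‖x - y‖⁻¹ * intDeriv β y ![cartVec i]) • dx i := by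
    ext1 x
    simp only [deltaPotential, formIntegral_deltaIntegrand]
  have hdP : dPotential β = fun x => (∫ y, ‖x - y‖⁻¹ * extDeriv β y cartVec) • unitForm := by
    ext1 x
    simp only [dPotential, formIntegral_dIntegrand]
  refine ⟨fun i x => ?_, fun x => ?_, ?_, ?_, fun x => ?_⟩
  · exact (((hC i).integrable_kernel x).smul_const unitForm).congr
      (.of_forall fun y => (deltaIntegrand_eq i x y).symm)
  · exact ((hD.integrable_kernel x).smul_const unitForm).congr
      (.of_forall fun y => (dIntegrand_eq x y).symm)
  · rw [hδP]
    intro x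
    exact DifferentiableAt.fun_sum fun i _ =>
      ((hC i).hasFDerivAt x).differentiableAt.smul_const _
  · rw [hdP]
    intro x
    exact (hD.hasFDerivAt x).differentiableAt.smul_const _
  · apply E3Form.two_ext
    intro r
    have hβd : ∀ (y : E3) (v : Fin 2 → E3), HasFDerivAt (fun y => β y v)
        ((ContinuousAlternatingMap.apply ℝ E3 ℝ v).comp (fderiv ℝ β y)) y := fun y v =>
      (ContinuousAlternatingMap.apply ℝ E3 ℝ v).hasFDerivAt.comp y
        (hβ.differentiable one_ne_zero y).hasFDerivAt
    have fB : ∀ (i : Fin 3) (y u : E3),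
        fderiv ℝ (fun y => β y ![cartVec (i + 1), cartVec (i + 2)]) y u =
          fderiv ℝ β y u ![cartVec (i + 1), cartVec (i + 2)] := fun i y u => by
      rw [(hβd y _).fderiv]; rfl
    have hB0 : Tendsto (fun y => β y ![cartVec (r + 1), cartVec (r + 2)]) (cocompact E3) (𝓝 0) := by
      have := ((ContinuousAlternatingMap.apply ℝ E3 ℝ
        ![cartVec (r + 1), cartVec (r + 2)]).continuous.tendsto 0).comp hβ_inf
      rwa [map_zero] at this
    have sw := fun (y u : E3) => E3Form.two_swap (fderiv ℝ β y u)
    have sl := fun (y u v : E3) => E3Form.two_self (fderiv ℝ β y u) v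
    have ne1 : ∀ r : Fin 3, r + 1 ≠ r := by decide
    have ne2 : ∀ r : Fin 3, r + 2 ≠ r := by decide
    -- Here P = (δβ)_{r+2} and Q = -(δβ)_{r+1}. These signs match the (r+1, r+2) component of d of
    -- the 1-form potential.
    have main := helmholtz_component (B := fun i y => β y ![cartVec (i + 1), cartVec (i + 2)])
      (p := r + 1) (q := r + 2) (r := r)
      (fun i => (ContinuousAlternatingMap.apply ℝ E3 ℝ
        ![cartVec (i + 1), cartVec (i + 2)]).contDiff.comp hβ) hB0
      (ne1 r) (ne2 r)
      (fun f => by fin_cases r <;> simp [Fin.sum_univ_three] <;> ring)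
      hD (hC (r + 2)) (hC (r + 1)).neg
      (fun y => by simp only [fB, extDeriv_cartVec])
      (fun y => by
        simp only [fB, intDeriv_cartVec]
        fin_cases r <;> simp [Fin.sum_univ_three, sl]
        · rw [sw y _ (cartVec 2) (cartVec 0)]; ring
        · rw [sw y _ (cartVec 0) (cartVec 1)]; ring
        · rw [sw y _ (cartVec 1) (cartVec 2)]; ring)
      (fun y => by
        simp only [fB, intDeriv_cartVec]
        fin_cases r <;> simp [Fin.sum_univ_three, sl]
        · rw [sw y _ (cartVec 2) (cartVec 1)]; ring
        · rw [sw y _ (cartVec 0) (cartVec 2)]; ring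
        · rw [sw y _ (cartVec 1) (cartVec 0)]; ring) x
    have e1 := extDeriv_sum_smul_dx (fun i => (hC i).hasFDerivAt x) (r + 1) (r + 2)
    have e2 := intDeriv_smul_unitForm (hD.hasFDerivAt x) r
    rw [← hδP] at e1
    rw [← hdP] at e2
    rw [ContinuousAlternatingMap.sub_apply, ContinuousAlternatingMap.smul_apply,
      ContinuousAlternatingMap.smul_apply, e1, e2, smul_eq_mul, smul_eq_mul]
    have e3 : (∫ y, -intDeriv β y ![cartVec (r + 1)] • newtonGrad (y - x)) (cartVec (r + 2)) =
        -(∫ y, intDeriv β y ![cartVec (r + 1)] • newtonGrad (y - x)) (cartVec (r + 2)) := by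
      have : (fun y => -intDeriv β y ![cartVec (r + 1)] • newtonGrad (y - x)) =
          fun y => -(intDeriv β y ![cartVec (r + 1)] • newtonGrad (y - x)) :=
        funext fun y => _root_.neg_smul (intDeriv β y ![cartVec (r + 1)]) (newtonGrad (y - x))
      rw [this, integral_neg]
      rfl
    rw [e3] at main
    have hpi := Real.pi_ne_zero
    field_simp
    linarith
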